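/- **Conventions.** A ranked set is a set with a function $rank$ to $\mathbb N$. A hypergraph $G$ over a ranked set $C$ consists of a finite set $V_G$ of nodes, a finite set $E_G$ of edges, for each $e\in E_G$ a sequence $att(e)$ of pairwise distinct nodes and a label $lab(e)\in C$ with $rank(lab(e))=|att(e)|=:rank(e)$, and a sequence $ext_G$ of pairwise distinct external nodes; $rank(G):=|ext_G|$. Isomorphic hypergraphs are not distinguished. If $rank(e)=rank(H)$, then $G[e/H]$ is obtained from $G$ by removing $e$, inserting a disjoint copy of $H$, and fusing, for each $i$, the $i$-th external node of $H$ with the $i$-th node of $att(e)$; $G[e_1/H_1,\dots,e_k/H_k]$ denotes simultaneous replacement, and $G[e:=a]$ denotes relabelling of $e$ by $a$. The handle $a^\bullet$ has $n=rank(a)$ nodes $v_1,\dots,v_n$, a single edge, labelled $a$ and attached to $v_1\cdots v_n$, and external nodes $v_1\cdots v_n$. **Types of $\mathrm{HL}$.** They are the least ranked set such that: (i) every primitive type is a type, where there are countably infinitely many primitive types of each rank; (ii) if $N$ is a type and $D$ is a hypergraph with exactly one edge $d_0$ labelled by the special symbol $\$$, the other edges being labelled by types, and $rank(D)=rank(N)$,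 then $N\div D$ is a type of rank $rank(d_0)$; (iii) if $M$ is a hypergraph labelled by types, then $\times(M)$ is a type of rank $rank(M)$. **The calculus $\mathrm{HL}$.** It derives sequents $H\to A$, where $A$ is a type and $H$ is a hypergraph labelled by types with $rank(H)=rank(A)$, from the axioms $p^\bullet\to p$ ($p$ primitive) by the following rules. * $(\div\to)$: let $e\in E_H$ be labelled by $N$, and let $D$ have the edges $d_0,\dots,d_k$ with $d_0$ labelled by $\$$ and $d_i$ labelled by $T_i$ for $i\ge1$. From $H\to A$ and $H_1\to T_1,\dots,H_k\to T_k$ infer $H[e/D][d_0:=N\div D][d_1/H_1,\dots,d_k/H_k]\to A$. * $(\to\div)$: from $D[d_0/F]\to N$, where $d_0$ is the $\$$-edge of $D$, infer $F\to N\div D$. * $(\times\to)$: if $e\in E_G$ is labelled by $\times(F)$, from $G[e/F]\to A$ infer $G\to A$. * $(\to\times)$: if $E_M=\{m_1,\dots,m_l\}$, from $H_i\to lab(m_i)$ for all $i=1,\dots,l$ infer $M[m_1/H_1,\dots,m_l/H_l]\to\times(M)$. **Grammars.** An HL-grammar $\langle\Sigma,S,\triangleright\rangle$ consists of a finite ranked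 alphabet $\Sigma$, a type $S$, and a finite relation $\triangleright$ between symbols and types of the same rank. Its language is the set of all hypergraphs $G$ over $\Sigma$ whose edge labels can be replaced, each label $a$ by some type $T$ with $a\triangleright T$, so that for the resulting hypergraph $G'$ the sequent $G'\to S$ is derivable in $\mathrm{HL}$. **The grammar $HGr_2$.** Let $p\neq q$ be primitive types of rank $1$. For $r\in\{p,q\}$ put $R_1(r)=r$ and $R_k(r)=r\div D_k$ for $k=2,3,4$, where all edges of $D_k$ have rank $1$ and $D_k$ has exactly one external node, $v$, to which the $\$$-edge is attached, and moreover: * $D_2$ has the only node $v$ and one further edge, labelled $r$, attached to $v$; * $D_3$ has one more node $u$ and one further edge, labelled $r$, attached to $u$; * $D_4$ has one more node $u$ and two further edges, both labelled $r$, one attached to $v$ and one attached to $u$. For $1\le i,j\le4$ let $M^{ij}=\times(M)$, where $M$ has exactly two nodes $v_1,v_2$, external nodes $v_1v_2$, and two edges of rank $1$: one labelled $R_i(p)$ attached to $v_1$ and one labelled $R_j(q)$ attached to $v_2$. Let $S=\times(M')$, where $M'$ has exactly two nodes, no external nodes, and two edges of rank $1$: one labelled $p$ attached to the first node and one labelled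 $q$ attached to the second. Let $HGr_2=\langle\{\ast\},S,\triangleright\rangle$, where $rank(\ast)=2$ and $\ast\triangleright M^{ij}$ for all $1\le i,j\le4$ (and nothing else). **Proposition.** $L(HGr_2)=\mathcal L_2$, where $\mathcal L_2$ is the set of all nonempty finite hypergraphs over $\{\ast\}$ (so every edge has rank $2$) without isolated nodes and without external nodes that are bipartite, i.e. whose node set is the union of two disjoint sets $V_1,V_2$ such that the first attachment node of every edge belongs to $V_1$ and the second one belongs to $V_2$. -/

import Mathlib

/-!  Hypergraphs, the hypergraph Lambek calculus `HL`, hypergraph Lambek grammars, the grammar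
`HGr₂`, and the language `𝓛₂` of bipartite binary graphs.

A ranked set is given as a family `C : ℕ → Type u`: the elements of rank `n` are those of `C n`. -/

universe u

namespace HypLambek

/-- A finite hypergraph without its labels: finite sets of nodes and edges, each edge `e` with
`rk e` pairwise distinct attachment nodes in a fixed order, and `n` pairwise distinct external
nodes in a fixed order. -/
structure Shape (n : ℕ) where
  V : Type
  E : Type
  finV : Finite V
  finE : Finite E
  rk : E → ℕ
  att : (e : E) → Fin (rk e) ↪ V
  ext : Fin n ↪ V

/-- A hypergraph of rank `n` over the ranked set `C`; the label of `e` has the rank of `e`. -/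
structure Hypergraph (C : ℕ → Type u) (n : ℕ) extends Shape n where
  lab : (e : E) → C (rk e)

/-- An isomorphism of hypergraphs, as far as nodes, edges, attachment and external nodes are
concerned. -/
structure Shape.Iso {n : ℕ} (G H : Shape n) where
  V : G.V ≃ H.V
  E : G.E ≃ H.E
  rk : ∀ e, H.rk (E e) = G.rk e
  att : ∀ e i, H.att (E e) (Fin.cast (rk e).symm i) = V (G.att e i)
  ext : ∀ i, H.ext i = V (G.ext i)

/-- A hypergraph of rank `n`, all of whose edges are labelled by `C` except for exactly one edge
of rank `k` that is labelled by `$`.  That edge is kept apart from the others: `E`, `rk`, `att`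
and `lab` describe the others, and `dollar` is the attachment of the `$`-edge. -/
structure Denominator (C : ℕ → Type u) (n k : ℕ) extends Hypergraph C n where
  dollar : Fin k ↪ V

section Replacement

variable {C : ℕ → Type u} {n : ℕ}

/-- The handle `a•`. -/
def handle (a : C n) : Hypergraph C n where
  V := Fin n
  E := Unit
  finV := inferInstance
  finE := inferInstance
  rk := fun _ => n
  att := fun _ => Function.Embedding.refl _
  ext := Function.Embedding.refl _
  lab := fun _ => a

/-- The nodes of a hypergraph that are not external. -/
def Shape.Internal (H : Shape n) : Type := {v : H.V // v ∉ Set.range H.ext}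

open Classical in
/-- Glue `H` along an ordered set `a` of nodes of `W`: the `i`-th external node of `H` becomes the
node `a i`, and the internal nodes of `H` stay new. -/
noncomputable def Shape.glue {W : Type} (H : Shape n) (a : Fin n ↪ W) :
    H.V ↪ W ⊕ H.Internal where
  toFun v := if h : v ∈ Set.range H.ext then Sum.inl (a h.choose) else Sum.inr ⟨v, h⟩
  inj' := by
    intro v w hvw
    by_cases hv : v ∈ Set.range H.ext <;> by_cases hw : w ∈ Set.range H.ext
    · simp only [hv, hw, dif_pos, Sum.inl.injEq] at hvw
      rw [← hv.choose_spec, ← hw.choose_spec, a.injective hvw]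
    · simp [hv, hw] at hvw
    · simp [hv, hw] at hvw
    · simp only [hv, hw, dif_neg, not_false_eq_true] at hvw
      exact congrArg Subtype.val (Sum.inr.inj hvw)

/-- Simultaneous hyperedge replacement: for each `i : I`, the edge `ι i` of `G` is removed, a
disjoint copy of `K i` is inserted, and the `j`-th external node of `K i` is fused with the `j`-th
attachment node of `ι i`.  All other edges of `G` stay. -/
noncomputable def Hypergraph.replace (G : Hypergraph C n) {I : Type} (ι : I ↪ G.E)
    (K : (i : I) → Hypergraph C (G.rk (ι i))) : Hypergraph C n where
  V := G.V ⊕ (Σ i, (K i).Internal)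
  E := {e : G.E // e ∉ Set.range ι} ⊕ (Σ i, (K i).E)
  finV := by
    have := G.finV
    have := G.finE
    have : Finite I := Finite.of_injective ι ι.injective
    have : ∀ i, Finite (K i).Internal := fun i => by
      have := (K i).finV
      unfold Shape.Internal
      infer_instance
    infer_instance
  finE := by
    have := G.finE
    have : Finite I := Finite.of_injective ι ι.injective
    have := fun i => (K i).finE
    infer_instance
  rk := fun e => match e with
    | Sum.inl e => G.rk e.1
    | Sum.inr ⟨i, e⟩ => (K i).rk e
  att := fun e => match e with
    | Sum.inl e => (G.att e.1).trans Function.Embedding.inl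
    | Sum.inr ⟨i, e⟩ => (((K i).att e).trans ((K i).glue (G.att (ι i)))).trans
        ((Function.Embedding.refl _).sumMap (Function.Embedding.sigmaMk (β := fun i => (K i).Internal) i))
  ext := G.ext.trans Function.Embedding.inl
  lab := fun e => match e with
    | Sum.inl e => G.lab e.1
    | Sum.inr ⟨i, e⟩ => (K i).lab e

/-- The embedding of a one-point type at the point `x`. -/
def pt {I X : Type} [Subsingleton I] (x : X) : I ↪ X :=
  ⟨fun _ => x, Function.injective_of_subsingleton _⟩

/-- `G[e/H]` -/
noncomputable def Hypergraph.replaceOne (G : Hypergraph C n) (e : G.E)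
    (H : Hypergraph C (G.rk e)) : Hypergraph C n :=
  G.replace (I := Unit) (pt e) (fun _ => H)

/-- `G[e₁/K₁, …, eₗ/Kₗ]` where `e₁, …, eₗ` are all edges of `G` -/
noncomputable def Hypergraph.replaceAll (G : Hypergraph C n)
    (K : (e : G.E) → Hypergraph C (G.rk e)) : Hypergraph C n :=
  G.replace (Function.Embedding.refl _) K

/-- `D[d₀ := a]`: the hypergraph `D` in which the label `$` of the edge `d₀` (here `none`) is
replaced by `a`. -/
def Denominator.relabel {k : ℕ} (D : Denominator C n k) (a : C k) : Hypergraph C n where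
  V := D.V
  E := Option D.E
  finV := D.finV
  finE := by
    have := D.finE
    infer_instance
  rk := fun e => match e with
    | none => k
    | some d => D.rk d
  att := fun e => match e with
    | none => D.dollar
    | some d => D.att d
  ext := D.ext
  lab := fun e => match e with
    | none => a
    | some d => D.lab d

end Replacement

/-- The types of the hypergraph Lambek calculus; `Tp n` is the set of types of rank `n`.  There
are countably many primitive types `prim n i` of each rank `n`.  The constructors `div` and
`times` are used through `Tp.over` and `Tp.prod` below. -/
inductive Tp : ℕ → Type 1
  | prim (n i : ℕ) : Tp n
  | div {n k : ℕ} (N : Tp n) (D : Shape n) (lab : (e : D.E) → Tp (D.rk e))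
      (dollar : Fin k ↪ D.V) : Tp k
  | times {n : ℕ} (M : Shape n) (lab : (e : M.E) → Tp (M.rk e)) : Tp n

/-- `N ÷ D` -/
def Tp.over {n k : ℕ} (N : Tp n) (D : Denominator Tp n k) : Tp k :=
  Tp.div N D.toShape D.lab D.dollar

/-- `×(M)` -/
def Tp.prod {n : ℕ} (M : Hypergraph Tp n) : Tp n :=
  Tp.times M.toShape M.lab

/-- Isomorphic hypergraphs are not distinguished, hence neither are types that differ only in the
names of the nodes and edges of the hypergraphs they are built from: `Tp.Same T T'` says that `T`
and `T'` are the same type in this sense. -/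
inductive Tp.Same : {m n : ℕ} → Tp m → Tp n → Prop
  | prim (n i : ℕ) : Tp.Same (Tp.prim n i) (Tp.prim n i)
  | div {n k : ℕ} {N N' : Tp n} {D D' : Shape n} {lab : (e : D.E) → Tp (D.rk e)}
      {lab' : (e : D'.E) → Tp (D'.rk e)} {dollar : Fin k ↪ D.V} {dollar' : Fin k ↪ D'.V}
      (φ : D.Iso D') :
      Tp.Same N N' → (∀ e, Tp.Same (lab e) (lab' (φ.E e))) →
      (∀ i, dollar' i = φ.V (dollar i)) →
      Tp.Same (Tp.div N D lab dollar) (Tp.div N' D' lab' dollar')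
  | times {n : ℕ} {M M' : Shape n} {lab : (e : M.E) → Tp (M.rk e)}
      {lab' : (e : M'.E) → Tp (M'.rk e)} (φ : M.Iso M') :
      (∀ e, Tp.Same (lab e) (lab' (φ.E e))) →
      Tp.Same (Tp.times M lab) (Tp.times M' lab')

/-- Two hypergraphs labelled by types are isomorphic. -/
def Same {n : ℕ} (G H : Hypergraph Tp n) : Prop :=
  ∃ φ : G.toShape.Iso H.toShape, ∀ e, Tp.Same (G.lab e) (H.lab (φ.E e))

/-- `HL H A` says that the sequent `H → A` is derivable in the hypergraph Lambek calculus.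
In the rule `(÷ →)` the hypergraph `H[e/D][d₀ := N ÷ D][d₁/K₁, …]` is written, as the order of
replacements does not matter, as `H[e / D[d₀ := N ÷ D][d₁/K₁, …]]`. -/
inductive HL : {n : ℕ} → Hypergraph Tp n → Tp n → Prop
  /-- the axiom `p• → p` -/
  | ax (n i : ℕ) : HL (handle (Tp.prim n i)) (Tp.prim n i)
  /-- the rule `(÷ →)`, where `N` is the label of `e` in `H` -/
  | divLeft {n k : ℕ} {H : Hypergraph Tp n} {A : Tp n} (e : H.E)
      (D : Denominator Tp (H.rk e) k) (K : (d : D.E) → Hypergraph Tp (D.rk d)) :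
      HL H A → (∀ d, HL (K d) (D.lab d)) →
      HL (H.replaceOne e
        ((D.relabel (Tp.over (H.lab e) D)).replace Function.Embedding.some K)) A
  /-- the rule `(→ ÷)`; the label that `d₀` has before it is replaced by `F` plays no role -/
  | divRight {n k : ℕ} {F : Hypergraph Tp k} {N : Tp n} (D : Denominator Tp n k) :
      HL ((D.relabel (Tp.over N D)).replaceOne none F) N → HL F (Tp.over N D)
  /-- the rule `(× →)` -/
  | timesLeft {n : ℕ} {G : Hypergraph Tp n} {A : Tp n} (e : G.E)
      (F : Hypergraph Tp (G.rk e)) :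
      G.lab e = Tp.prod F → HL (G.replaceOne e F) A → HL G A
  /-- the rule `(→ ×)` -/
  | timesRight {n : ℕ} (M : Hypergraph Tp n) (K : (m : M.E) → Hypergraph Tp (M.rk m)) :
      (∀ m, HL (K m) (M.lab m)) → HL (M.replaceAll K) (Tp.prod M)
  /-- isomorphic hypergraphs are not distinguished -/
  | iso {n : ℕ} {H H' : Hypergraph Tp n} {A A' : Tp n} :
      Same H H' → Tp.Same A A' → HL H A → HL H' A'

/-- A hypergraph Lambek grammar over a finite ranked alphabet `Alph`: a distinguished type `S` of
some rank, and a finite relation between symbols and types of the same rank. -/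
structure HLGrammar (Alph : ℕ → Type) where
  finAlph : Finite (Σ n, Alph n)
  rank : ℕ
  S : Tp rank
  corr : {n : ℕ} → Alph n → Tp n → Prop
  finCorr : Set.Finite {x : (n : ℕ) × (Alph n × Tp n) | corr x.2.1 x.2.2}

/-- Replace the labels of a hypergraph by `f`. -/
def Hypergraph.mapLab {C : ℕ → Type u} {C' : ℕ → Type*} {n : ℕ} (G : Hypergraph C n)
    (f : (e : G.E) → C' (G.rk e)) : Hypergraph C' n :=
  { G.toShape with lab := f }

/-- The language generated by a hypergraph Lambek grammar, as a set of hypergraphs of any rank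
over its alphabet.  (`f_G(G) → S` is a sequent only if `G` and `S` have the same rank.) -/
def HLGrammar.language {Alph : ℕ → Type} (g : HLGrammar Alph) :
    Set (Σ n, Hypergraph Alph n) :=
  {X | ∃ G : Hypergraph Alph g.rank, X = ⟨g.rank, G⟩ ∧
    ∃ f : (e : G.E) → Tp (G.rk e),
      (∀ e, g.corr (G.lab e) (f e)) ∧ HL (G.mapLab f) g.S}

/-- The ranked alphabet `{∗}`, where `∗` has rank `2`. -/
inductive Star : ℕ → Type
  | star : Star 2

/-- The language `𝓛₁` of all nonempty binary graphs over `{∗}` without isolated nodes and without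
external nodes. -/
def L1 : Set (Σ n, Hypergraph Star n) :=
  {X | X.1 = 0 ∧ Nonempty X.2.V ∧ (∀ e, X.2.rk e = 2) ∧
    ∀ v, ∃ e, v ∈ Set.range (X.2.att e)}

/-- The nodes can be divided into two disjoint subsets `V₁`, `V₂` such that each edge goes from a
node in `V₁` to a node in `V₂`. -/
def Shape.Bipartite {n : ℕ} (G : Shape n) : Prop :=
  ∃ V₁ V₂ : Set G.V, Disjoint V₁ V₂ ∧ V₁ ∪ V₂ = Set.univ ∧
    ∀ (e : G.E) (i : Fin (G.rk e)),
      (i.val = 0 → G.att e i ∈ V₁) ∧ (i.val = 1 → G.att e i ∈ V₂)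

/-- The language `𝓛₂` of all bipartite graphs in `𝓛₁`. -/
def L2 : Set (Σ n, Hypergraph Star n) :=
  {X | X ∈ L1 ∧ X.2.Bipartite}

/-- The shape with nodes `0, …, v - 1`, edges `0, …, m - 1` of rank `1`, edge `e` being attached
to the node `a e`, and external nodes `ext`. -/
def unary {n : ℕ} (v m : ℕ) (a : Fin m → Fin v) (ext : Fin n ↪ Fin v) : Shape n where
  V := Fin v
  E := Fin m
  finV := inferInstance
  finE := inferInstance
  rk := fun _ => 1
  att := fun e => pt (a e)
  ext := ext

/-- `r ÷ D`, where `D` has one node; `$` and an `r`-edge are attached to it; it is external. -/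
def R2 (r : Tp 1) : Tp 1 :=
  Tp.over r
    { unary 1 1 ![0] (pt 0) with
      lab := fun _ => r
      dollar := pt (0 : Fin 1) }

/-- `r ÷ D`, where `D` has two nodes; `$` is attached to node `0`, an `r`-edge is attached to
node `1`; node `0` is external. -/
def R3 (r : Tp 1) : Tp 1 :=
  Tp.over r
    { unary 2 1 ![1] (pt 0) with
      lab := fun _ => r
      dollar := pt (0 : Fin 2) }

/-- `r ÷ D`, where `D` has two nodes; `$` and an `r`-edge are attached to node `0`, another
`r`-edge is attached to node `1`; node `0` is external. -/
def R4 (r : Tp 1) : Tp 1 :=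
  Tp.over r
    { unary 2 2 ![0, 1] (pt 0) with
      lab := fun _ => r
      dollar := pt (0 : Fin 2) }

/-- `R_1(r), …, R_4(r)`, numbered from `0`. -/
def R (i : Fin 4) (r : Tp 1) : Tp 1 := ![r, R2 r, R3 r, R4 r] i

/-- `×(M)`, where `M` has two nodes, which are its external nodes in this order; an `R_i(p)`-edge
is attached to the first one and an `R_j(q)`-edge to the second one. -/
def M (p q : Tp 1) (i j : Fin 4) : Tp 2 :=
  Tp.prod
    { unary 2 2 ![0, 1] (Function.Embedding.refl _) with
      lab := ![R i p, R j q] }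

/-- `×(M)`, where `M` has two nodes, none of them external; a `p`-edge is attached to the first
one and a `q`-edge to the second one. -/
def S (p q : Tp 1) : Tp 0 :=
  Tp.prod
    { unary 2 2 ![0, 1] ⟨Fin.elim0, fun x => x.elim0⟩ with
      lab := ![p, q] }

/-- The grammar `HGr₂`: the alphabet is `{∗}`, the distinguished type is `S`, and `∗` corresponds
to the types `M^{ij}`. -/
def HGr2 (p q : Tp 1) : HLGrammar Star where
  finAlph := by
    have : Subsingleton (Σ n, Star n) := ⟨by rintro ⟨_, ⟨⟩⟩ ⟨_, ⟨⟩⟩; rfl⟩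
    infer_instance
  rank := 0
  S := S p q
  corr := fun {n} _ T => ∃ i j : Fin 4, (⟨n, T⟩ : Σ n, Tp n) = ⟨2, M p q i j⟩
  finCorr := by
    refine (Set.finite_range (fun ij : Fin 4 × Fin 4 =>
      (⟨2, Star.star, M p q ij.1 ij.2⟩ : (n : ℕ) × (Star n × Tp n)))).subset ?_
    rintro ⟨n, ⟨⟩, T⟩ ⟨i, j, h⟩
    cases h
    exact ⟨(i, j), rfl⟩

end HypLambek

namespace HypLambek
open Set Function

/-! Every generated graph lies in `L2` by a sound model of the calculus. Each primitive type is a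
colour; a hypergraph with coloured nodes is remembered only through the colour sets of its external
nodes and the colour sets occurring at internal nodes (`Colouring`). Types denote sets of
colourings, and the calculus preserves membership (`HL.sound`), because hyperedge replacement
amounts to composition of colourings (`Hypergraph.colouring_replace`). Every denominator in the
grammar has all its nodes covered by edges, so each `R i r` contains the denotation of `r`. Hence
the edge that colours its first node `a` and its second node `b` belongs to every `M` type.
Membership of the whole graph in the denotation of `S` then says that there is a node and that every
node has colour set exactly `{a}` or `{b}`. This gives nonemptiness, absence of isolated nodes and,
as `a ≠ b`, bipartiteness.

Conversely, given a graph in `L2`, choose at each node one designated edge end, and choose an edge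
whose two ends are the roots of the two classes. Designated ends are labelled `r` at roots and `R3
r` elsewhere; all other ends are labelled `R2 r`. Expanding the products leaves unary edges only
(`HL.mixed_of_monadic`). Read backwards, `(÷ →)` with `R2` deletes a superfluous edge at a root, and
with `R3` deletes an exhausted root and passes its `r` to another node of the class. What remains in
the end is the hypergraph of `S` (`HL.monadic_of_designated`). The label `R4` is never needed. -/

/-! ### Gluing along external nodes -/

theorem Shape.glue_ext {n : ℕ} {W : Type} (H : Shape n) (a : Fin n ↪ W) (j : Fin n) :
    H.glue a (H.ext j) = Sum.inl (a j) := by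
  have h : H.ext j ∈ range H.ext := ⟨j, rfl⟩
  have h' : H.ext h.choose = H.ext j := h.choose_spec
  refine (dif_pos h).trans ?_
  rw [H.ext.injective h']

theorem Shape.glue_internal {n : ℕ} {W : Type} (H : Shape n) (a : Fin n ↪ W) (v : H.V)
    (h : v ∉ range H.ext) : H.glue a v = Sum.inr ⟨v, h⟩ :=
  dif_neg h

theorem Shape.glue_eq_inl {n : ℕ} {W : Type} {H : Shape n} {a : Fin n ↪ W} {v : H.V} {x : W}
    (h : H.glue a v = Sum.inl x) : ∃ j, v = H.ext j ∧ a j = x := by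
  by_cases hv : v ∈ range H.ext
  · obtain ⟨j, rfl⟩ := hv
    rw [H.glue_ext] at h
    exact ⟨j, rfl, Sum.inl.inj h⟩
  · rw [H.glue_internal a v hv] at h
    cases h

theorem Shape.glue_eq_inr {n : ℕ} {W : Type} {H : Shape n} {a : Fin n ↪ W} {v : H.V}
    {x : H.Internal} (h : H.glue a v = Sum.inr x) : v = x.1 := by
  by_cases hv : v ∈ range H.ext
  · obtain ⟨j, rfl⟩ := hv
    rw [H.glue_ext] at h
    cases h
  · rw [H.glue_internal a v hv] at h
    exact congrArg Subtype.val (Sum.inr.inj h)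

/-! ### A sound interpretation of the calculus -/

/-- What the interpretation retains of a hypergraph with coloured nodes: the set of colours of each
external node, and the colour sets that occur at internal nodes. -/
@[ext]
structure Colouring where
  outer : ℕ → Set ℕ
  inner : Set (Set ℕ)

/-- The colours of the node `v` when each edge `e` is replaced by a hypergraph coloured by
`y e`. -/
def Shape.colours {n : ℕ} (H : Shape n) (y : H.E → Colouring) (v : H.V) : Set ℕ :=
  {k | ∃ e i, H.att e i = v ∧ k ∈ (y e).outer i}

/-- The colouring of the hypergraph obtained when each edge `e` is replaced by a hypergraph
coloured by `y e`. -/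
def Shape.colouring {n : ℕ} (H : Shape n) (y : H.E → Colouring) : Colouring where
  outer j := {k | ∃ h : j < n, k ∈ H.colours y (H.ext ⟨j, h⟩)}
  inner := {s | (∃ v, v ∉ range H.ext ∧ s = H.colours y v) ∨ ∃ e, s ∈ (y e).inner}

/-- The shape `D` together with its `$`-edge. -/
def Shape.addEdge {n k : ℕ} (D : Shape n) (dollar : Fin k ↪ D.V) : Shape n :=
  (Denominator.relabel (C := fun _ => Unit) { D with lab := fun _ => (), dollar := dollar }
    ()).toShape

/-- The interpretation of types as sets of colourings. -/
def Tp.interp : {n : ℕ} → Tp n → Set Colouring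
  -- Internal nodes coloured `{i}` have to be allowed, because the denominators of `R3` and `R4`
  -- have an internal node.
  | _, .prim n i => {x | (∀ j < n, x.outer j = {i}) ∧ x.inner ⊆ {{i}}}
  | _, .div N D lab dollar => {x | ∀ y : D.E → Colouring, (∀ e, y e ∈ (lab e).interp) →
      (D.addEdge dollar).colouring (fun e => e.elim x y) ∈ N.interp}
  | _, .times M lab => {x | ∃ y : M.E → Colouring, (∀ e, y e ∈ (lab e).interp) ∧
      x = M.colouring y}

/-! ### Invariance of the interpretation under isomorphism -/

theorem Shape.Iso.colours_eq {n : ℕ} {G H : Shape n} (φ : G.Iso H) {y : G.E → Colouring}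
    {z : H.E → Colouring} (h : ∀ e, z (φ.E e) = y e) (v : G.V) :
    H.colours z (φ.V v) = G.colours y v := by
  ext k
  constructor
  · rintro ⟨e, i, hv, hk⟩
    obtain ⟨e, rfl⟩ := φ.E.surjective e
    refine ⟨e, Fin.cast (φ.rk e) i, ?_, ?_⟩
    · apply φ.V.injective
      rw [← hv, ← φ.att]
      rfl
    · rwa [← h]
  · rintro ⟨e, i, hv, hk⟩
    exact ⟨φ.E e, Fin.cast (φ.rk e).symm i, by rw [φ.att, hv], by rwa [h]⟩

theorem Shape.Iso.colouring_eq {n : ℕ} {G H : Shape n} (φ : G.Iso H) {y : G.E → Colouring}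
    {z : H.E → Colouring} (h : ∀ e, z (φ.E e) = y e) : H.colouring z = G.colouring y := by
  have hr : ∀ v, φ.V v ∈ range H.ext ↔ v ∈ range G.ext := fun v => by
    simp only [mem_range, φ.ext, φ.V.injective.eq_iff]
  ext1
  · funext j
    ext k
    simp only [Shape.colouring, φ.ext, φ.colours_eq h]
  · ext s
    simp only [Shape.colouring, mem_ofPred_eq]
    rw [← φ.V.exists_congr_right, ← φ.E.exists_congr_right]
    simp only [hr, φ.colours_eq h, h]

/-- Isomorphisms extend to the `$`-edge. -/
def Shape.Iso.addEdge {n k : ℕ} {D D' : Shape n} (φ : D.Iso D') {dollar : Fin k ↪ D.V}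
    {dollar' : Fin k ↪ D'.V} (h : ∀ i, dollar' i = φ.V (dollar i)) :
    (D.addEdge dollar).Iso (D'.addEdge dollar') where
  V := φ.V
  E := Equiv.optionCongr φ.E
  rk := fun e => match e with
    | none => rfl
    | some d => φ.rk d
  att := fun e => match e with
    | none => h
    | some d => φ.att d
  ext := φ.ext

theorem Tp.Same.interp_eq {m n : ℕ} {T : Tp m} {T' : Tp n} (h : Tp.Same T T') :
    T.interp = T'.interp := by
  induction h with
  | prim => rfl
  | div φ _ _ hd ihN ih =>
    ext x
    simp only [Tp.interp, mem_ofPred_eq, ihN]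
    constructor
    · intro hx y hy
      -- The arguments `y` are universally quantified, so they are transported along `φ` here and
      -- along its inverse in the other direction.
      rw [(φ.addEdge hd).colouring_eq (y := fun e => e.elim x fun d => y (φ.E d))
        (by rintro (_ | _) <;> rfl)]
      exact hx _ fun e => by rw [ih]; exact hy _
    · intro hx y hy
      rw [← (φ.addEdge hd).colouring_eq (z := fun e => e.elim x fun d => y (φ.E.symm d))
        (by
          rintro (_ | d)
          · rfl
          · exact congrArg y (φ.E.symm_apply_apply d))]
      refine hx _ fun e => ?_
      obtain ⟨e, rfl⟩ := φ.E.surjective e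
      rw [← ih]
      simpa using hy e
  | times φ _ ih =>
    ext x
    simp only [Tp.interp, mem_ofPred_eq]
    constructor
    · rintro ⟨y, hy, rfl⟩
      refine ⟨fun e => y (φ.E.symm e), fun e => ?_, (φ.colouring_eq fun e => by simp).symm⟩
      obtain ⟨e, rfl⟩ := φ.E.surjective e
      rw [← ih]
      simpa using hy e
    · rintro ⟨y, hy, rfl⟩
      exact ⟨fun e => y (φ.E e), fun e => by rw [ih]; exact hy _, φ.colouring_eq fun e => rfl⟩

/-! ### Colourings and hyperedge replacement -/

section Replace

variable {C : ℕ → Type u} {n : ℕ} {G : Hypergraph C n} {I : Type} {ι : I ↪ G.E}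
  {K : (i : I) → Hypergraph C (G.rk (ι i))} {y : (G.replace ι K).E → Colouring}
  {z : G.E → Colouring}

/-- An inserted edge reaches an old node only through an external node of `K i`, and the colours
gathered there are exactly the outer part of `z (ι i)`. -/
theorem Hypergraph.colours_replace_inl
    (hι : ∀ i, z (ι i) = (K i).colouring fun e => y (Sum.inr ⟨i, e⟩))
    (hz : ∀ e, z e.1 = y (Sum.inl e)) (v : G.V) :
    (G.replace ι K).colours y (Sum.inl v) = G.colours z v := by
  ext k
  constructor
  · rintro ⟨e | ⟨i, e⟩, j, hv, hk⟩
    · exact ⟨e.1, j, Sum.inl.inj hv, by rwa [hz]⟩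
    · change Sum.map id (fun w => (⟨i, w⟩ : Σ i, (K i).Internal))
        ((K i).glue (G.att (ι i)) ((K i).att e j)) = _ at hv
      obtain ⟨w, hw, rfl⟩ : ∃ w, (K i).glue (G.att (ι i)) ((K i).att e j) = Sum.inl w ∧ w = v := by
        cases h : (K i).glue (G.att (ι i)) ((K i).att e j) with
        | inl w => rw [h] at hv; exact ⟨w, rfl, Sum.inl.inj hv⟩
        | inr w => rw [h] at hv; cases hv
      obtain ⟨m, hm, rfl⟩ := Shape.glue_eq_inl hw
      refine ⟨ι i, m, rfl, ?_⟩
      rw [hι]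
      exact ⟨m.2, e, j, hm, hk⟩
  · rintro ⟨e, j, rfl, hk⟩
    by_cases he : e ∈ range ι
    · obtain ⟨i, rfl⟩ := he
      rw [hι] at hk
      obtain ⟨_, e, m, hm, hk⟩ := hk
      refine ⟨Sum.inr ⟨i, e⟩, m, ?_, hk⟩
      change Sum.map id (fun w => (⟨i, w⟩ : Σ i, (K i).Internal))
          ((K i).glue (G.att (ι i)) ((K i).att e m)) = _
      rw [hm, Shape.glue_ext]
      rfl
    · exact ⟨Sum.inl ⟨e, he⟩, j, rfl, by rwa [← hz]⟩

/-- An internal node of an inserted hypergraph meets no edges but those of its own copy. -/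
theorem Hypergraph.colours_replace_inr (i : I) (v : (K i).Internal) :
    (G.replace ι K).colours y (Sum.inr ⟨i, v⟩) =
      (K i).colours (fun e => y (Sum.inr ⟨i, e⟩)) v.1 := by
  ext k
  constructor
  · rintro ⟨e | ⟨i', e⟩, j, hv, hk⟩
    · cases hv
    · change Sum.map id (fun w => (⟨i', w⟩ : Σ i, (K i).Internal))
        ((K i').glue (G.att (ι i')) ((K i').att e j)) = _ at hv
      cases h : (K i').glue (G.att (ι i')) ((K i').att e j) with
      | inl w => rw [h] at hv; cases hv
      | inr w =>
        rw [h] at hv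
        cases hv
        exact ⟨e, j, Shape.glue_eq_inr h, hk⟩
  · rintro ⟨e, j, hv, hk⟩
    refine ⟨Sum.inr ⟨i, e⟩, j, ?_, hk⟩
    change Sum.map id (fun w => (⟨i, w⟩ : Σ i, (K i).Internal))
        ((K i).glue (G.att (ι i)) ((K i).att e j)) = _
    rw [hv, Shape.glue_internal _ _ _ v.2]
    rfl

/-- Compositionality: it suffices to colour each replaced edge by the colouring of what is inserted
for it. Every replacement in `HL.sound` is evaluated this way. -/
theorem Hypergraph.colouring_replace
    (hι : ∀ i, z (ι i) = (K i).colouring fun e => y (Sum.inr ⟨i, e⟩))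
    (hz : ∀ e, z e.1 = y (Sum.inl e)) :
    (G.replace ι K).colouring y = G.colouring z := by
  ext1
  · funext j
    ext k
    simp only [Shape.colouring, mem_ofPred_eq]
    exact exists_congr fun h => by rw [← Hypergraph.colours_replace_inl hι hz]; rfl
  · ext s
    constructor
    · rintro (⟨v | ⟨i, v⟩, hv, rfl⟩ | ⟨e | ⟨i, e⟩, hs⟩)
      · refine Or.inl ⟨v, ?_, Hypergraph.colours_replace_inl hι hz v⟩
        rintro ⟨j, rfl⟩
        exact hv ⟨j, rfl⟩
      · refine Or.inr ⟨ι i, ?_⟩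
        rw [hι, Hypergraph.colours_replace_inr]
        exact Or.inl ⟨v.1, v.2, rfl⟩
      · exact Or.inr ⟨e.1, by rwa [hz]⟩
      · refine Or.inr ⟨ι i, ?_⟩
        rw [hι]
        exact Or.inr ⟨e, hs⟩
    · rintro (⟨v, hv, rfl⟩ | ⟨e, hs⟩)
      · refine Or.inl ⟨Sum.inl v, ?_, (Hypergraph.colours_replace_inl hι hz v).symm⟩
        rintro ⟨j, hj⟩
        exact hv ⟨j, Sum.inl.inj hj⟩
      · by_cases he : e ∈ range ι
        · obtain ⟨i, rfl⟩ := he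
          rw [hι] at hs
          obtain ⟨v, hv, rfl⟩ | ⟨e, hs⟩ := hs
          · refine Or.inl ⟨Sum.inr ⟨i, v, hv⟩, ?_,
              (Hypergraph.colours_replace_inr i ⟨v, hv⟩).symm⟩
            rintro ⟨j, hj⟩
            cases hj
          · exact Or.inr ⟨Sum.inr ⟨i, e⟩, hs⟩
        · exact Or.inr ⟨Sum.inl ⟨e, he⟩, by rwa [← hz]⟩

end Replace

/-! ### Soundness -/

/-- The label of the `$`-edge does not matter for the shape. -/
def Denominator.relabelIso {C : ℕ → Type u} {n k : ℕ} (D : Denominator C n k) (a : C k) :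
    (D.toShape.addEdge D.dollar).Iso (D.relabel a).toShape where
  V := Equiv.refl _
  E := Equiv.refl _
  rk := fun e => match e with
    | none => rfl
    | some _ => rfl
  att := fun e => match e with
    | none => fun _ => rfl
    | some _ => fun _ => rfl
  ext := fun _ => rfl

theorem Denominator.colouring_relabel {C : ℕ → Type u} {n k : ℕ} (D : Denominator C n k)
    (a : C k) (x : Colouring) (y : D.E → Colouring) :
    (D.relabel a).colouring (fun e : Option D.E => e.elim x y) =
      (D.toShape.addEdge D.dollar).colouring (fun e : Option D.E => e.elim x y) :=
  (D.relabelIso a).colouring_eq fun _ => rfl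

theorem HL.sound {n : ℕ} {H : Hypergraph Tp n} {A : Tp n} (h : HL H A) :
    ∀ y : H.E → Colouring, (∀ e, y e ∈ (H.lab e).interp) → H.colouring y ∈ A.interp := by
  classical
  induction h with
  | ax n i =>
    intro y hy
    obtain ⟨h₁, h₂⟩ := hy ()
    refine ⟨fun j hj => ?_, ?_⟩
    · rw [← h₁ j hj]
      ext k
      constructor
      · rintro ⟨_, ⟨⟩, m, hm, hk⟩
        have : m = ⟨j, hj⟩ := hm
        subst this
        exact hk
      · exact fun hk => ⟨hj, (), ⟨j, hj⟩, rfl, hk⟩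
    · rintro s (⟨v, hv, -⟩ | ⟨⟨⟩, hs⟩)
      · exact (hv ⟨v, rfl⟩).elim
      · exact h₂ hs
  | @divLeft n k H A e D K _ _ ih ihK =>
    intro y hy
    let x : D.E → Colouring := fun d => (K d).colouring fun c => y (Sum.inr ⟨(), Sum.inr ⟨d, c⟩⟩)
    have hnone : none ∉ range (Embedding.some : D.E ↪ Option D.E) := by
      rintro ⟨_, h⟩
      cases h
    let x₀ : Colouring := y (Sum.inr ⟨(), Sum.inl ⟨none, hnone⟩⟩)
    -- The colouring of the hypergraph inserted for `e`: the denominator with `x₀` on the `$`-edge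
    -- and the premises `K d` on the others.
    let t : Colouring := (D.toShape.addEdge D.dollar).colouring fun d => d.elim x₀ x
    let z : H.E → Colouring := fun e' =>
      if h : e' ∈ range (pt e : Unit ↪ H.E) then t else y (Sum.inl ⟨e', h⟩)
    have hz : (H.replaceOne e
        ((D.relabel (Tp.over (H.lab e) D)).replace Embedding.some K)).colouring y =
        H.colouring z := by
      refine Hypergraph.colouring_replace ?_ ?_
      · rintro ⟨⟩
        have : z e = t := dif_pos ⟨(), rfl⟩
        refine this.trans ((D.colouring_relabel (Tp.over (H.lab e) D) _ _).symm.trans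
          (Eq.symm ?_))
        refine Hypergraph.colouring_replace (G := D.relabel (Tp.over (H.lab e) D))
          (ι := Embedding.some) (K := K)
          (y := fun c => y (Sum.inr ⟨(), c⟩)) (z := fun d => d.elim x₀ x) ?_ ?_
        · intro d
          rfl
        · rintro ⟨_ | d, hd⟩
          · rfl
          · exact (hd ⟨d, rfl⟩).elim
      · rintro ⟨e', he'⟩
        exact dif_neg he'
    rw [hz]
    refine ih z fun e' => ?_
    by_cases he' : e' ∈ range (pt e : Unit ↪ H.E)
    · have h : z e' = t := dif_pos he'
      rw [h]
      obtain ⟨-, rfl⟩ := he'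
      -- The colouring `x₀` lies in the denotation of `N ÷ D`; applied to the arguments `x` it puts
      -- `t` into that of `N`.
      exact hy (Sum.inr ⟨(), Sum.inl ⟨none, hnone⟩⟩) x fun d =>
        ihK d _ fun c => hy (Sum.inr ⟨(), Sum.inr ⟨d, c⟩⟩)
    · have h : z e' = y (Sum.inl ⟨e', he'⟩) := dif_neg he'
      rw [h]
      exact hy (Sum.inl ⟨e', he'⟩)
  | @divRight n k F N D _ ih =>
    intro y hy x hx
    let u : ((D.relabel (Tp.over N D)).replaceOne none F).E → Colouring := fun e => match e with
      -- The empty colouring is a dummy: the `$`-edge has been replaced by `F`, so `none` does not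
      -- occur.
      | Sum.inl e => e.1.elim ⟨fun _ => ∅, ∅⟩ x
      | Sum.inr c => y c.2
    have hu : ((D.relabel (Tp.over N D)).replaceOne none F).colouring u =
        (D.toShape.addEdge D.dollar).colouring (fun e => e.elim (F.colouring y) x) := by
      refine Eq.trans ?_ (D.colouring_relabel (Tp.over N D) _ _)
      refine Hypergraph.colouring_replace (G := D.relabel (Tp.over N D)) (I := Unit) (ι := pt none)
        (K := fun _ => F)
        (y := u) (z := fun e => e.elim (F.colouring y) x) (fun _ => rfl) ?_
      rintro ⟨_ | d, hd⟩
      · exact (hd ⟨(), rfl⟩).elim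
      · rfl
    rw [← hu]
    refine ih u ?_
    rintro (⟨_ | d, hd⟩ | c)
    · exact (hd ⟨(), rfl⟩).elim
    · exact hx d
    · exact hy c.2
  | @timesLeft n G A e F he _ ih =>
    intro y hy
    have hye := hy e
    rw [he] at hye
    obtain ⟨x, hx, hyx⟩ := hye
    let u : (G.replaceOne e F).E → Colouring := fun e => match e with
      | Sum.inl e => y e.1
      | Sum.inr c => x c.2
    have hu : (G.replaceOne e F).colouring u = G.colouring y :=
      Hypergraph.colouring_replace (z := y) (fun _ => hyx) fun _ => rfl
    rw [← hu]
    refine ih u ?_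
    rintro (e' | c)
    · exact hy e'.1
    · exact hx c.2
  | @timesRight n M K _ ih =>
    intro y hy
    let z : M.E → Colouring := fun m => (K m).colouring fun c => y (Sum.inr ⟨m, c⟩)
    refine ⟨z, fun m => ih m _ fun c => hy (Sum.inr ⟨m, c⟩), ?_⟩
    refine Hypergraph.colouring_replace (G := M) (ι := Embedding.refl _) (K := K) (y := y) (z := z)
        (fun _ => rfl) ?_
    rintro ⟨e, he⟩
    exact (he ⟨e, rfl⟩).elim
  | iso hH hA _ ih =>
    intro y hy
    obtain ⟨φ, hφ⟩ := hH
    rw [← hA.interp_eq, φ.colouring_eq (y := fun e => y (φ.E e)) fun e => rfl]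
    exact ih _ fun e => by rw [(hφ e).interp_eq]; exact hy _

/-! ### Derived rules -/

/-- The identity isomorphism. -/
def Shape.Iso.refl {n : ℕ} (G : Shape n) : G.Iso G where
  V := Equiv.refl _
  E := Equiv.refl _
  rk := fun _ => rfl
  att := fun _ _ => rfl
  ext := fun _ => rfl

theorem Tp.Same.refl {n : ℕ} (T : Tp n) : Tp.Same T T := by
  induction T with
  | prim => exact .prim _ _
  | div N D lab dollar ihN ih => exact .div (Shape.Iso.refl D) ihN ih fun _ => rfl
  | times M lab ih => exact .times (Shape.Iso.refl M) ih

theorem Tp.Same.of_eq {n : ℕ} {T T' : Tp n} (h : T = T') : Tp.Same T T' :=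
  h ▸ Tp.Same.refl T

/-- The inverse isomorphism. -/
def Shape.Iso.symm {n : ℕ} {G H : Shape n} (φ : G.Iso H) : H.Iso G where
  V := φ.V.symm
  E := φ.E.symm
  rk := fun e => by rw [← φ.rk, Equiv.apply_symm_apply]
  att := by
    intro e i
    obtain ⟨e, rfl⟩ := φ.E.surjective e
    rw [Equiv.eq_symm_apply]
    -- Generalised to a variable `e'`, since the type of the position `i` depends on the edge.
    have h : ∀ e' (he : e' = e) (hr : H.rk (φ.E e) = G.rk e'),
        φ.V (G.att e' (Fin.cast hr i)) = H.att (φ.E e) i := by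
      rintro e' rfl hr
      rw [← φ.att]
      rfl
    exact h _ (φ.E.symm_apply_apply e) _
  ext := fun i => by rw [φ.ext, Equiv.symm_apply_apply]

theorem Tp.Same.symm {m n : ℕ} {T : Tp m} {T' : Tp n} (h : Tp.Same T T') : Tp.Same T' T := by
  induction h with
  | prim => exact .prim _ _
  | @div _ _ _ _ D D' lab lab' _ _ φ _ _ hd ihN ih =>
    refine .div φ.symm ihN (fun e => ?_) fun i => ?_
    · have h : ∀ e', φ.E e' = e → Tp.Same (lab' e) (lab e') := by
        rintro e' rfl
        exact ih e'
      exact h _ (φ.E.apply_symm_apply e)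
    · rw [hd]
      exact (φ.V.symm_apply_apply _).symm
  | @times _ D D' lab lab' φ _ ih =>
    refine .times φ.symm fun e => ?_
    have h : ∀ e', φ.E e' = e → Tp.Same (lab' e) (lab e') := by
      rintro e' rfl
      exact ih e'
    exact h _ (φ.E.apply_symm_apply e)

theorem Same.symm {n : ℕ} {G H : Hypergraph Tp n} (h : Same G H) : Same H G := by
  obtain ⟨φ, hφ⟩ := h
  refine ⟨φ.symm, fun e => ?_⟩
  have h : ∀ e', φ.E e' = e → Tp.Same (H.lab e) (G.lab e') := by
    rintro e' rfl
    exact (hφ e').symm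
  exact h _ (φ.E.apply_symm_apply e)

/-- To identify the result of a replacement in `G`, map the nodes of `G` by `f` and the nodes of
the inserted hypergraphs by `g`, compatibly with fusion. -/
theorem Hypergraph.same_replace {n : ℕ} {G H : Hypergraph Tp n} {I : Type} {ι : I ↪ G.E}
    {K : (i : I) → Hypergraph Tp (G.rk (ι i))} (f : G.V → H.V) (g : ∀ i, (K i).V → H.V)
    (hg : ∀ i j, g i ((K i).ext j) = f (G.att (ι i) j))
    (hV : Bijective (Sum.elim f fun x : Σ i, (K i).Internal => g x.1 x.2.1))
    (φ : (G.replace ι K).E → H.E) (hφ : Bijective φ)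
    (rk_inl : ∀ e, H.rk (φ (Sum.inl e)) = G.rk e.1)
    (rk_inr : ∀ i e, H.rk (φ (Sum.inr ⟨i, e⟩)) = (K i).rk e)
    (att_inl : ∀ e j, H.att (φ (Sum.inl e)) (Fin.cast (rk_inl e).symm j) = f (G.att e.1 j))
    (att_inr : ∀ i e j,
      H.att (φ (Sum.inr ⟨i, e⟩)) (Fin.cast (rk_inr i e).symm j) = g i ((K i).att e j))
    (ext : ∀ j, H.ext j = f (G.ext j))
    (lab_inl : ∀ e, Tp.Same (G.lab e.1) (H.lab (φ (Sum.inl e))))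
    (lab_inr : ∀ i e, Tp.Same ((K i).lab e) (H.lab (φ (Sum.inr ⟨i, e⟩)))) :
    Same (G.replace ι K) H := by
  refine ⟨⟨Equiv.ofBijective _ hV, Equiv.ofBijective φ hφ, ?_, ?_, ext⟩, ?_⟩
  · rintro (e | ⟨i, e⟩)
    · exact rk_inl e
    · exact rk_inr i e
  · rintro (e | ⟨i, e⟩) j
    · exact att_inl e j
    · refine (att_inr i e j).trans ?_
      change _ = Sum.elim f (fun x : Σ i, (K i).Internal => g x.1 x.2.1)
        (Sum.map id (fun w => (⟨i, w⟩ : Σ i, (K i).Internal))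
            ((K i).glue (G.att (ι i)) ((K i).att e j)))
      by_cases h : (K i).att e j ∈ range (K i).ext
      · obtain ⟨m, hm⟩ := h
        rw [← hm, Shape.glue_ext, hg]
        rfl
      · rw [Shape.glue_internal _ _ _ h]
        rfl
  · rintro (e | ⟨i, e⟩)
    · exact lab_inl e
    · exact lab_inr i e

/-! ### Derivations with edges of rank one and two -/

/-- The hypergraph of rank `0` with nodes `V`, with edges `E` of rank `2` labelled by the types
`×(M)` where `M` has two nodes, both external, and an edge labelled `l e i` attached to the `i`-th
of them, and with edges `X` of rank `1` labelled by `lab`. -/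
def mixed (V E X : Type) [hV : Finite V] [hE : Finite E] [hX : Finite X] (att : E → Fin 2 ↪ V)
    (l : E → Fin 2 → Tp 1) (at' : X → V) (lab : X → Tp 1) : Hypergraph Tp 0 where
  V := V
  E := E ⊕ X
  finV := hV
  finE := inferInstance
  rk := fun e => match e with
    | Sum.inl _ => 2
    | Sum.inr _ => 1
  att := fun e => match e with
    | Sum.inl e => att e
    | Sum.inr x => pt (at' x)
  ext := ⟨Fin.elim0, fun x => x.elim0⟩
  lab := fun e => match e with
    | Sum.inl e => Tp.prod
        { unary 2 2 ![0, 1] (Function.Embedding.refl _) with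
          lab := l e }
    | Sum.inr x => lab x

/-- The hypergraph of rank `0` with nodes `V` and edges `X` of rank `1` labelled by `lab`. -/
def monadic (V X : Type) [hV : Finite V] [hX : Finite X] (at' : X → V) (lab : X → Tp 1) :
    Hypergraph Tp 0 where
  V := V
  E := X
  finV := hV
  finE := hX
  rk := fun _ => 1
  att := fun x => pt (at' x)
  ext := ⟨Fin.elim0, fun x => x.elim0⟩
  lab := lab

theorem HL.monadic_congr {V V' X X' : Type} [Finite V] [Finite V'] [Finite X] [Finite X']
    {f : X → V} {f' : X' → V'} {lab : X → Tp 1} {lab' : X' → Tp 1} {A : Tp 0}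
    (φ : V ≃ V') (ψ : X ≃ X') (hf : ∀ x, f' (ψ x) = φ (f x)) (hlab : ∀ x, lab' (ψ x) = lab x)
    (h : HL (monadic V X f lab) A) : HL (monadic V' X' f' lab') A := by
  have hs : Same (monadic V X f lab) (monadic V' X' f' lab') :=
    ⟨⟨φ, ψ, fun _ => rfl, fun x _ => hf x, fun i => i.elim0⟩,
      fun x => Tp.Same.of_eq (hlab x).symm⟩
  exact h.iso hs (Tp.Same.refl A)

/-- This is `(× →)` at the edge `none`; the two unary edges inside the product join `X`. -/
theorem HL.mixed_option {V E X : Type} [Finite V] [Finite E] [Finite X]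
    {att : Option E → Fin 2 ↪ V} {l : Option E → Fin 2 → Tp 1} {f : X → V} {lab : X → Tp 1}
    {A : Tp 0}
    (h : HL (mixed V E (X ⊕ Fin 2) (fun e => att (some e)) (fun e => l (some e))
      (Sum.elim f (att none)) (Sum.elim lab (l none))) A) :
    HL (mixed V (Option E) X att l f lab) A := by
  refine HL.timesLeft (G := mixed V (Option E) X att l f lab) (Sum.inl none)
    { unary 2 2 ![0, 1] (Function.Embedding.refl _) with lab := l none } rfl ?_
  refine h.iso (Same.symm ?_) (Tp.Same.refl A)
  let G := mixed V (Option E) X att l f lab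
  let F : Hypergraph Tp 2 :=
    { unary 2 2 ![0, 1] (Function.Embedding.refl _) with lab := l none }
  let φ : (G.replaceOne (Sum.inl none) F).E → E ⊕ (X ⊕ Fin 2) := fun e => match e with
    | Sum.inl ⟨Sum.inl none, he⟩ => (he ⟨(), rfl⟩).elim
    | Sum.inl ⟨Sum.inl (some e), _⟩ => Sum.inl e
    | Sum.inl ⟨Sum.inr x, _⟩ => Sum.inr (Sum.inl x)
    | Sum.inr ⟨_, i⟩ => Sum.inr (Sum.inr i)
  refine Hypergraph.same_replace id (fun _ => att none) (fun _ _ => rfl) ?_ φ ?_ ?_ ?_ ?_ ?_ ?_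
    ?_ ?_
  · constructor
    · rintro (v | ⟨_, v, hv⟩) (w | ⟨_, w, hw⟩) h
      -- Both nodes of the inserted hypergraph are external, so no new nodes arise and the remaining
      -- cases are void.
      · exact congrArg _ h
      · exact (hw ⟨w, rfl⟩).elim
      · exact (hv ⟨v, rfl⟩).elim
      · exact (hv ⟨v, rfl⟩).elim
    · exact fun v => ⟨Sum.inl v, rfl⟩
  · constructor
    · rintro (⟨(_ | e) | x, he⟩ | ⟨_, i⟩) (⟨(_ | e') | x', he'⟩ | ⟨_, i'⟩) h
      all_goals first | exact (he ⟨(), rfl⟩).elim | exact (he' ⟨(), rfl⟩).elim | (cases h <;> rfl)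
    · rintro (e | x | i)
      · exact ⟨Sum.inl ⟨Sum.inl (some e), by rintro ⟨_, h⟩; cases h⟩, rfl⟩
      · exact ⟨Sum.inl ⟨Sum.inr x, by rintro ⟨_, h⟩; cases h⟩, rfl⟩
      · exact ⟨Sum.inr ⟨(), i⟩, rfl⟩
  · rintro ⟨(_ | e) | x, he⟩
    · exact (he ⟨(), rfl⟩).elim
    · rfl
    · rfl
  · exact fun _ _ => rfl
  · rintro ⟨(_ | e) | x, he⟩ j
    · exact (he ⟨(), rfl⟩).elim
    · rfl
    · rfl
  · rintro _ e j
    have he : ∀ e : Fin 2, e = ![0, 1] e := by decide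
    exact congrArg (att none) (he e)
  · exact fun i => i.elim0
  · rintro ⟨(_ | e) | x, he⟩
    · exact (he ⟨(), rfl⟩).elim
    · exact Tp.Same.refl _
    · exact Tp.Same.refl _
  · exact fun _ _ => Tp.Same.refl _

theorem HL.mixed_congr {V E E' X : Type} [Finite V] [Finite E] [Finite E'] [Finite X]
    (φ : E ≃ E') {att : E' → Fin 2 ↪ V} {l : E' → Fin 2 → Tp 1} {f : X → V} {lab : X → Tp 1}
    {A : Tp 0} (h : HL (mixed V E X (fun e => att (φ e)) (fun e => l (φ e)) f lab) A) :
    HL (mixed V E' X att l f lab) A := by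
  have hs : Same (mixed V E X (fun e => att (φ e)) (fun e => l (φ e)) f lab)
      (mixed V E' X att l f lab) := by
    refine ⟨⟨Equiv.refl V, Equiv.sumCongr φ (Equiv.refl X), ?_, ?_, fun i => i.elim0⟩, ?_⟩
    · rintro (e | x) <;> rfl
    · rintro (e | x) i <;> rfl
    · rintro (e | x) <;> exact Tp.Same.refl _
  exact h.iso hs (Tp.Same.refl A)

theorem HL.mixed_of_isEmpty {V E X : Type} [Finite V] [Finite E] [Finite X] [IsEmpty E]
    {att : E → Fin 2 ↪ V} {l : E → Fin 2 → Tp 1} {f : X → V} {lab : X → Tp 1}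
    {A : Tp 0} (h : HL (monadic V X f lab) A) : HL (mixed V E X att l f lab) A := by
  have hs : Same (monadic V X f lab) (mixed V E X att l f lab) :=
    ⟨⟨Equiv.refl V, (Equiv.emptySum E X).symm, fun _ => rfl, fun _ _ => rfl,
      fun i => i.elim0⟩, fun _ => Tp.Same.refl _⟩
  exact h.iso hs (Tp.Same.refl A)

/-- All edges of rank `2` can be expanded at once. -/
theorem HL.mixed_of_monadic {V : Type} [Finite V] {A : Tp 0} (E : Type) [hE : Finite E] :
    ∀ (X : Type) [Finite X] (att : E → Fin 2 ↪ V) (l : E → Fin 2 → Tp 1) (f : X → V)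
      (lab : X → Tp 1),
      HL (monadic V (X ⊕ E × Fin 2) (Sum.elim f fun y => att y.1 y.2)
        (Sum.elim lab fun y => l y.1 y.2)) A →
      HL (mixed V E X att l f lab) A := by
  revert hE
  -- `X` must vary in the induction, as it collects the unary edges of the products already
  -- expanded.
  refine Finite.induction_empty_option (P := fun E => ∀ [Finite E],
    ∀ (X : Type) [Finite X] (att : E → Fin 2 ↪ V) (l : E → Fin 2 → Tp 1) (f : X → V)
      (lab : X → Tp 1),
      HL (monadic V (X ⊕ E × Fin 2) (Sum.elim f fun y => att y.1 y.2)
        (Sum.elim lab fun y => l y.1 y.2)) A →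
      HL (mixed V E X att l f lab) A) ?_ ?_ ?_ E
  · intro E E' φ ih _ X _ att l f lab h
    have := Finite.of_equiv _ φ.symm
    refine HL.mixed_congr φ (ih X _ _ _ _ (HL.monadic_congr (Equiv.refl _)
      (Equiv.sumCongr (Equiv.refl X) (Equiv.prodCongr φ.symm (Equiv.refl _))) ?_ ?_ h))
    · rintro (x | ⟨e, i⟩)
      · rfl
      · exact congrArg (fun e => att e i) (φ.apply_symm_apply e)
    · rintro (x | ⟨e, i⟩)
      · rfl
      · exact congrArg (fun e => l e i) (φ.apply_symm_apply e)
  · intro _ X _ att l f lab h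
    refine HL.mixed_of_isEmpty (HL.monadic_congr (Equiv.refl _) (Equiv.sumEmpty X _) ?_ ?_ h)
    · rintro (x | ⟨⟨⟩, i⟩)
      rfl
    · rintro (x | ⟨⟨⟩, i⟩)
      rfl
  · intro E _ ih _ X _ att l f lab h
    have : Finite E := inferInstance
    let ψ : X ⊕ Option E × Fin 2 ≃ (X ⊕ Fin 2) ⊕ E × Fin 2 :=
      { toFun := fun x => match x with
          | Sum.inl x => Sum.inl (Sum.inl x)
          | Sum.inr (none, i) => Sum.inl (Sum.inr i)
          | Sum.inr (some e, i) => Sum.inr (e, i)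
        invFun := fun x => match x with
          | Sum.inl (Sum.inl x) => Sum.inl x
          | Sum.inl (Sum.inr i) => Sum.inr (none, i)
          | Sum.inr (e, i) => Sum.inr (some e, i)
        left_inv := by rintro (x | ⟨_ | e, i⟩) <;> rfl
        right_inv := by rintro ((x | i) | ⟨e, i⟩) <;> rfl }
    refine HL.mixed_option (ih _ _ _ _ _ (HL.monadic_congr (Equiv.refl _) ψ ?_ ?_ h))
    · rintro (x | ⟨_ | e, i⟩) <;> rfl
    · rintro (x | ⟨_ | e, i⟩) <;> rfl

/-- The effect of `(÷ →)` on a hypergraph with edges of rank `1` only, when the denominator has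
a single edge besides the `$`-edge and is applied to the axiom `p• → p`. -/
theorem HL.monadic_div {V V' X X' : Type} [Finite V] [Finite V'] [Finite X] [Finite X']
    {f : X → V} {f' : X' → V'} {lab : X → Tp 1} {lab' : X' → Tp 1} {A : Tp 0} {m a : ℕ}
    (i : Fin (m + 1)) (x₀ : X) (d : X') (nV : V → V') (g : Fin (m + 1) → V') (nE : X → X')
    (hx₀ : lab x₀ = Tp.prim 1 a) (hg : g 0 = nV (f x₀))
    (hV : Bijective (Sum.elim nV fun v : {v : Fin (m + 1) // v ≠ 0} => g v))
    (hE : Injective nE) (hd : ∀ x', x' ≠ d ↔ ∃ x, nE x = x')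
    (hf : ∀ x, x ≠ x₀ → f' (nE x) = nV (f x)) (hfx₀ : f' (nE x₀) = g i) (hfd : f' d = g 0)
    (hlab : ∀ x, lab' (nE x) = lab x)
    (hlabd : lab' d = Tp.over (Tp.prim 1 a)
      { unary (m + 1) 1 ![i] (pt 0) with
        lab := fun _ => Tp.prim 1 a
        dollar := pt (0 : Fin (m + 1)) })
    (h : HL (monadic V X f lab) A) : HL (monadic V' X' f' lab') A := by
  let D : Denominator Tp 1 1 :=
    { unary (m + 1) 1 ![i] (pt 0) with
      lab := fun _ => Tp.prim 1 a
      dollar := pt (0 : Fin (m + 1)) }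
  let K : (d : D.E) → Hypergraph Tp (D.rk d) := fun _ => handle (Tp.prim 1 a)
  have key := HL.divLeft (H := monadic V X f lab) x₀ D K h fun _ => HL.ax 1 a
  refine key.iso ?_ (Tp.Same.refl A)
  have hnone : none ∉ range (Embedding.some : D.E ↪ Option D.E) := by
    rintro ⟨_, h⟩
    cases h
  let F := (D.relabel (Tp.over (lab x₀) D)).replace Embedding.some K
  -- The former `$`-edge becomes `d`, and the edge of the inserted axiom handle takes over the name
  -- of the removed edge `x₀`.
  let φ : ((monadic V X f lab).replaceOne x₀ F).E → X' :=
    Sum.elim (fun e => nE e.1) fun c => Sum.elim (fun _ => d) (fun _ => nE x₀) c.2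
  have hdn : ∀ x, nE x ≠ d := fun x => (hd _).2 ⟨x, rfl⟩
  -- Nodes of the denominator are placed by `g`; handles have no internal nodes, so the second
  -- summand is empty.
  refine Hypergraph.same_replace nV (fun _ v => Sum.elim g (fun w => (w.2.2 ⟨w.2.1, rfl⟩).elim) v)
    ?_ ?_ φ ?_ ?_ ?_ ?_ ?_ ?_ ?_ ?_
  · exact fun _ _ => hg
  · constructor
    · have inj : ∀ v : Fin (m + 1), (Sum.inl v : F.V) ∉ range F.ext → v ≠ 0 := by
        rintro v hv rfl
        exact hv ⟨0, rfl⟩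
      rintro (v | ⟨_, v | w, hv⟩) (v' | ⟨_, v' | w', hv'⟩) h
      · exact congrArg _ (Sum.inl.inj (hV.1 (a₁ := Sum.inl v) (a₂ := Sum.inl v') h))
      · cases hV.1 (a₁ := Sum.inl v) (a₂ := Sum.inr ⟨v', inj v' hv'⟩) h
      · exact (w'.2.2 ⟨w'.2.1, rfl⟩).elim
      · cases hV.1 (a₁ := Sum.inr ⟨v, inj v hv⟩) (a₂ := Sum.inl v') h
      · cases hV.1 (a₁ := Sum.inr ⟨v, inj v hv⟩) (a₂ := Sum.inr ⟨v', inj v' hv'⟩) h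
        rfl
      · exact (w'.2.2 ⟨w'.2.1, rfl⟩).elim
      all_goals exact (w.2.2 ⟨w.2.1, rfl⟩).elim
    · intro v
      obtain ⟨v | ⟨v, hv⟩, rfl⟩ := hV.2 v
      · exact ⟨Sum.inl v, rfl⟩
      · refine ⟨Sum.inr ⟨(), Sum.inl v, ?_⟩, rfl⟩
        rintro ⟨j, hj⟩
        exact hv (Sum.inl.inj hj).symm
  · constructor
    · rintro (⟨e, he⟩ | ⟨_, ⟨_ | e, he⟩ | ⟨e, ⟨⟩⟩⟩) (⟨e', he'⟩ | ⟨_, ⟨_ | e', he'⟩ | ⟨e', ⟨⟩⟩⟩) h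
      · cases hE h
        rfl
      · exact (hdn _ h).elim
      · exact (he' ⟨e', rfl⟩).elim
      · exact (he ⟨(), (hE h).symm⟩).elim
      · exact (hdn _ h.symm).elim
      · rfl
      · exact (he' ⟨e', rfl⟩).elim
      · exact (hdn _ h.symm).elim
      · exact (he ⟨e, rfl⟩).elim
      · exact (he ⟨e, rfl⟩).elim
      · exact (he ⟨e, rfl⟩).elim
      · exact (he ⟨e, rfl⟩).elim
      · exact (he' ⟨(), hE h⟩).elim
      · exact (hdn _ h).elim
      · exact (he' ⟨e', rfl⟩).elim
      · have : e = e' := Subsingleton.elim (α := Fin 1) _ _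
        rw [this]
    · intro x'
      by_cases hx' : x' = d
      · exact ⟨Sum.inr ⟨(), Sum.inl ⟨none, hnone⟩⟩, hx'.symm⟩
      · obtain ⟨x, rfl⟩ := (hd x').1 hx'
        by_cases hx : x = x₀
        · exact ⟨Sum.inr ⟨(), Sum.inr ⟨(0 : Fin 1), ()⟩⟩, by rw [hx]; rfl⟩
        · exact ⟨Sum.inl ⟨x, fun ⟨_, h⟩ => hx h.symm⟩, rfl⟩
  · exact fun _ => rfl
  · rintro _ (⟨_ | e, he⟩ | ⟨e, ⟨⟩⟩)
    · rfl
    · exact (he ⟨e, rfl⟩).elim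
    · rfl
  · rintro ⟨e, he⟩ j
    exact hf e fun h => he ⟨(), h.symm⟩
  · rintro _ (⟨_ | e, he⟩ | ⟨e, ⟨⟩⟩) j
    · exact hfd
    · exact (he ⟨e, rfl⟩).elim
    · refine hfx₀.trans ?_
      have hj : j = (0 : Fin 1) := Subsingleton.elim (α := Fin 1) _ _
      have he : e = (0 : Fin 1) := Subsingleton.elim (α := Fin 1) _ _
      subst hj he
      have hglue := Shape.glue_ext (handle (Tp.prim 1 a)).toShape (D.att (0 : Fin 1)) 0
      exact (congrArg (fun v => Sum.elim g (fun w : Σ d, (K d).Internal =>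
        (w.2.2 ⟨w.2.1, rfl⟩).elim) (Sum.map id (Embedding.sigmaMk (0 : Fin 1)) v)) hglue).symm
  · exact fun j => j.elim0
  · rintro ⟨e, he⟩
    exact Tp.Same.of_eq (hlab e).symm
  · rintro _ (⟨_ | e, he⟩ | ⟨e, ⟨⟩⟩)
    · refine Tp.Same.of_eq (hlabd.trans ?_).symm
      exact congrArg (fun T => Tp.over T D) hx₀.symm
    · exact (he ⟨e, rfl⟩).elim
    · exact Tp.Same.of_eq ((hlab x₀).trans hx₀).symm

/-- `(→ ×)` applied to two axioms: replacing every edge by its handle changes nothing up to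
isomorphism. -/
theorem HL.monadic_S (a b : ℕ) :
    HL (monadic (Fin 2) (Fin 2) ![0, 1] ![Tp.prim 1 a, Tp.prim 1 b])
      (S (Tp.prim 1 a) (Tp.prim 1 b)) := by
  let N : Hypergraph Tp 0 :=
    { unary 2 2 ![0, 1] ⟨Fin.elim0, fun x => x.elim0⟩ with
      lab := ![Tp.prim 1 a, Tp.prim 1 b] }
  let c : Fin 2 → ℕ := ![a, b]
  have hc : ∀ m, Tp.prim 1 (c m) = (![Tp.prim 1 a, Tp.prim 1 b] : Fin 2 → Tp 1) m := by
    intro m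
    fin_cases m <;> rfl
  let K : (m : N.E) → Hypergraph Tp (N.rk m) := fun m => handle (Tp.prim 1 (c m))
  have key := HL.timesRight N K fun m =>
    (HL.ax 1 (c m)).iso ⟨Shape.Iso.refl _, fun _ => Tp.Same.refl _⟩ (Tp.Same.of_eq (hc m))
  refine key.iso ?_ (Tp.Same.refl _)
  let φ : (N.replaceAll K).E → Fin 2 := Sum.elim (fun e => e.1) fun e => e.1
  refine Hypergraph.same_replace id (fun m _ => (![0, 1] : Fin 2 → Fin 2) m) (fun _ _ => rfl) ?_
    φ ?_ ?_ ?_ ?_ ?_ ?_ ?_ ?_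
  · constructor
    · rintro (v | ⟨_, v, hv⟩) (w | ⟨_, w, hw⟩) h
      · exact congrArg _ h
      · exact (hw ⟨w, rfl⟩).elim
      · exact (hv ⟨v, rfl⟩).elim
      · exact (hv ⟨v, rfl⟩).elim
    · exact fun v => ⟨Sum.inl v, rfl⟩
  · constructor
    · rintro (⟨e, he⟩ | ⟨e, ⟨⟩⟩) (⟨e', he'⟩ | ⟨e', ⟨⟩⟩) h
      · exact (he ⟨e, rfl⟩).elim
      · exact (he ⟨e, rfl⟩).elim
      · exact (he' ⟨e', rfl⟩).elim
      · cases (h : e = e')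
        rfl
    · exact fun m => ⟨Sum.inr ⟨m, ()⟩, rfl⟩
  · exact fun _ => rfl
  · exact fun _ _ => rfl
  · exact fun e => (e.2 ⟨e.1, rfl⟩).elim
  · exact fun _ _ _ => rfl
  · exact fun i => i.elim0
  · exact fun e => (e.2 ⟨e.1, rfl⟩).elim
  · exact fun m _ => Tp.Same.of_eq (hc m)

/-- A hypergraph whose nodes are divided into two classes derives `S` if each node carries one
edge labelled `r` or `R3 r`, the former exactly for one node of each class, and all other edges are
labelled `R2 r`, where `r` is the primitive type that belongs to the class. -/
theorem HL.monadic_of_designated (c : Fin 2 → ℕ) (n : ℕ) : ∀ (V X : Type) [Finite V] [Finite X]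
    (f : X → V) (lab : X → Tp 1) (col : V → Fin 2) (d : V → X) (root : Fin 2 → V),
    Nat.card X = n → (∀ v, f (d v) = v) → (∀ i, col (root i) = i) →
    (∀ i, lab (d (root i)) = Tp.prim 1 (c i)) →
    (∀ v, v ≠ root (col v) → lab (d v) = R3 (Tp.prim 1 (c (col v)))) →
    (∀ x, x ≠ d (f x) → lab x = R2 (Tp.prim 1 (c (col (f x))))) →
    HL (monadic V X f lab) (S (Tp.prim 1 (c 0)) (Tp.prim 1 (c 1))) := by
  classical
  induction n with
  | zero =>
    intro V X _ _ f lab col d root hX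
    have := (Finite.card_eq_zero_iff (α := X)).1 hX
    exact isEmptyElim (d (root 0))
  | succ n ih =>
    intro V X _ _ f lab col d root hX hd hroot hlab₁ hlab₃ hlab₂
    have hdi : Injective d := fun v w h => by rw [← hd v, h, hd]
    have hcard : ∀ x₁ : X, Nat.card {x // x ≠ x₁} = n := fun x₁ => by
      have h := Nat.card_congr (Equiv.optionSubtypeNe x₁)
      rw [Finite.card_option, hX] at h
      exact Nat.succ_injective h
    -- A non-designated edge at a root is labelled `R2 r` and can be absorbed by the `r` there; the
    -- denominator has the single node `0`, whence `m = 0`.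
    by_cases h₂ : ∃ i x, f x = root i ∧ x ≠ d (root i)
    · obtain ⟨i, x₁, hx₁, hne⟩ := h₂
      have hx₁d : ∀ v, d v ≠ x₁ := fun v h => hne (by rw [← hx₁, ← h, hd])
      refine HL.monadic_div (V := V) (X := {x // x ≠ x₁}) (f := fun x => f x.1)
        (lab := fun x => lab x.1) (m := 0) (a := c i) 0 ⟨d (root i), hx₁d _⟩ x₁ id
        (fun _ => root i) Subtype.val (hlab₁ i) (hd _).symm ?_ Subtype.val_injective
        (fun x => ⟨fun h => ⟨⟨x, h⟩, rfl⟩, fun ⟨y, hy⟩ => hy ▸ y.2⟩) (fun _ _ => rfl) (hd _) hx₁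
        (fun _ => rfl) ?_ ?_
      · constructor
        · rintro (v | ⟨v, hv⟩) (w | ⟨w, hw⟩) h
          · exact congrArg _ h
          · exact (hw (Subsingleton.elim (α := Fin 1) _ _)).elim
          · exact (hv (Subsingleton.elim (α := Fin 1) _ _)).elim
          · exact (hv (Subsingleton.elim (α := Fin 1) _ _)).elim
        · exact fun v => ⟨Sum.inl v, rfl⟩
      · rw [hlab₂ x₁ (by rwa [hx₁]), hx₁, hroot]
        rfl
      · exact ih V {x // x ≠ x₁} _ _ col (fun v => ⟨d v, hx₁d v⟩) root (hcard x₁) hd hroot hlab₁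
          hlab₃ fun x hx => hlab₂ x.1 fun h => hx (Subtype.ext h)
    push Not at h₂
    -- Now each root carries only its `r`-edge. With the denominator of `R3`, whose node `0` is `v`
    -- and whose node `1` is `u`, the backward step removes the node `u` and the edge `d v`, and
    -- moves the `r`-edge `d u` to `v`, the new root of its class.
    by_cases h₃ : ∃ v, v ≠ root (col v)
    · obtain ⟨v, hv⟩ := h₃
      set u := root (col v) with hu
      have hcu : col u = col v := hroot _
      have hfu : ∀ x, x ≠ d u → f x ≠ u := fun x hx h => hx (h₂ _ x h)
      let f' : {x // x ≠ d v} → {w // w ≠ u} := fun x =>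
        if h : x.1 = d u then ⟨v, hv⟩ else ⟨f x.1, hfu _ h⟩
      have hf'u : ∀ h, f' ⟨d u, h⟩ = ⟨v, hv⟩ := fun h => dif_pos rfl
      have hf' : ∀ x : {x // x ≠ d v}, x.1 ≠ d u → (f' x).1 = f x.1 := fun x hx =>
        congrArg Subtype.val (dif_neg hx)
      let d' : {w // w ≠ u} → {x // x ≠ d v} := fun w =>
        if h : w.1 = v then ⟨d u, hdi.ne hv.symm⟩ else ⟨d w.1, hdi.ne h⟩
      have hd'v : ∀ h, d' ⟨v, h⟩ = ⟨d u, hdi.ne hv.symm⟩ := fun h => dif_pos rfl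
      have hd' : ∀ w : {w // w ≠ u}, w.1 ≠ v → (d' w).1 = d w.1 := fun w hw =>
        congrArg Subtype.val (dif_neg hw)
      let root' : Fin 2 → {w // w ≠ u} := fun i =>
        if h : root i = u then ⟨v, hv⟩ else ⟨root i, h⟩
      have hroot'u : ∀ i, root i = u → root' i = ⟨v, hv⟩ := fun i h => dif_pos h
      have hroot' : ∀ i, root i ≠ u → (root' i).1 = root i := fun i h =>
        congrArg Subtype.val (dif_neg h)
      have hrootv : ∀ i, root i ≠ v := fun i h => hv (by rw [hu, ← h, hroot])
      refine HL.monadic_div (V := {w // w ≠ u}) (X := {x // x ≠ d v}) (f := f')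
        (lab := fun x => lab x.1) (m := 1) (a := c (col v)) 1 ⟨d u, hdi.ne hv.symm⟩ (d v)
        Subtype.val ![v, u] Subtype.val (hlab₁ _) (by rw [hf'u]; rfl) ?_ Subtype.val_injective
        (fun x => ⟨fun h => ⟨⟨x, h⟩, rfl⟩, fun ⟨y, hy⟩ => hy ▸ y.2⟩)
        (fun x hx => (hf' x fun h => hx (Subtype.ext h)).symm) (hd u) (hd v) (fun _ => rfl)
        (hlab₃ v hv) ?_
      · constructor
        · rintro (w | ⟨w, hw⟩) (w' | ⟨w', hw'⟩) h
          · exact congrArg _ (Subtype.ext h)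
          · fin_cases w'
            · exact (hw' rfl).elim
            · exact (w.2 h).elim
          · fin_cases w
            · exact (hw rfl).elim
            · exact (w'.2 h.symm).elim
          · fin_cases w
            · exact (hw rfl).elim
            · fin_cases w'
              · exact (hw' rfl).elim
              · rfl
        · intro w
          by_cases hw : w = u
          · exact ⟨Sum.inr ⟨1, by decide⟩, hw.symm⟩
          · exact ⟨Sum.inl ⟨w, hw⟩, rfl⟩
      · refine ih _ _ f' _ (fun w => col w.1) d' root' (hcard _) ?_ ?_ ?_ ?_ ?_
        · rintro ⟨w, hw⟩
          by_cases hwv : w = v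
          · subst hwv
            rw [hd'v, hf'u]
          · refine Subtype.ext ?_
            rw [hf', hd' _ hwv, hd]
            rw [hd' _ hwv]
            exact hdi.ne hw
        · intro i
          by_cases hi : root i = u
          · rw [hroot'u i hi]
            change col v = i
            rw [← hcu, ← hi, hroot]
          · rw [hroot' i hi, hroot]
        · intro i
          by_cases hi : root i = u
          · rw [hroot'u i hi, hd'v]
            change lab (d u) = _
            rw [← hi, hlab₁]
          · rw [hd' _ (by rw [hroot' i hi]; exact hrootv i), hroot' i hi, hlab₁]
        · rintro ⟨w, hw⟩ hne
          have hwv : w ≠ v := by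
            rintro rfl
            exact hne (hroot'u _ rfl).symm
          rw [hd' _ hwv]
          refine hlab₃ w fun h => hne (Subtype.ext ?_)
          change w = (root' (col w)).1
          rw [hroot' _ fun h' => hw (h.trans h'), ← h]
        · rintro ⟨x, hx⟩ hne
          have hxu : x ≠ d u := by
            rintro rfl
            rw [hf'u, hd'v] at hne
            exact hne rfl
          have hfx := hf' ⟨x, hx⟩ hxu
          change lab x = R2 (Tp.prim 1 (c (col (f' ⟨x, hx⟩).1)))
          rw [hfx]
          refine hlab₂ x fun h => ?_
          by_cases hfv : f x = v
          · rw [hfv] at h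
            exact hx h
          · refine hne (Subtype.ext ?_)
            rw [hd' _ (by rw [hfx]; exact hfv), hfx]
            exact h
    push Not at h₃
    -- Only the two roots are left, each with exactly one edge.
    let φ : Fin 2 ≃ V := ⟨root, col, hroot, fun v => (h₃ v).symm⟩
    have hf : ∀ x, x = d (f x) := fun x => by
      have h := h₃ (f x)
      rw [h]
      exact h₂ _ x h
    let ψ : Fin 2 ≃ X := φ.trans ⟨d, f, hd, fun x => (hf x).symm⟩
    refine HL.monadic_congr φ ψ ?_ ?_ (HL.monadic_S (c 0) (c 1))
    · intro i
      refine (hd _).trans (congrArg root ?_)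
      fin_cases i <;> rfl
    · intro i
      refine (hlab₁ i).trans ?_
      fin_cases i <;> rfl

/-! ### Generated graphs belong to `L2` -/

/-- The edges supply no colour but `a`, and coverage of every node rules out the empty colour set.
-/
theorem Shape.colouring_mem_prim {n a : ℕ} {H : Shape n} {y : H.E → Colouring}
    (hy : ∀ e, y e ∈ (Tp.prim (H.rk e) a).interp) (hH : ∀ v, ∃ e, v ∈ range (H.att e)) :
    H.colouring y ∈ (Tp.prim n a).interp := by
  have hc : ∀ v, H.colours y v = {a} := by
    intro v
    ext k
    constructor
    · rintro ⟨e, i, -, hk⟩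
      rwa [(hy e).1 i i.2] at hk
    · rintro rfl
      obtain ⟨e, i, hi⟩ := hH v
      exact ⟨e, i, hi, by rw [(hy e).1 i i.2]; rfl⟩
  refine ⟨fun j hj => ?_, ?_⟩
  · ext k
    simp only [Shape.colouring, hc, mem_ofPred_eq, exists_prop]
    exact and_iff_right hj
  · rintro s (⟨v, -, rfl⟩ | ⟨e, hs⟩)
    · exact hc v
    · exact (hy e).2 hs

/-- With `x` on the `$`-edge, all edges of `D` have colour `a` and cover all nodes, so
`Shape.colouring_mem_prim` applies. -/
theorem Tp.prim_interp_subset_over {n k a : ℕ} (D : Denominator Tp n k)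
    (hD : ∀ e, D.lab e = Tp.prim (D.rk e) a)
    (hv : ∀ v, v ∈ range D.dollar ∨ ∃ e, v ∈ range (D.att e)) :
    (Tp.prim k a).interp ⊆ (Tp.over (Tp.prim n a) D).interp := by
  intro x hx y hy
  refine Shape.colouring_mem_prim ?_ fun v => ?_
  · rintro (_ | e)
    · exact hx
    · have h := hy e
      rw [hD] at h
      exact h
  · rcases hv v with h | ⟨e, h⟩
    · exact ⟨none, h⟩
    · exact ⟨some e, h⟩

theorem Tp.prim_interp_subset_R (i : Fin 4) (a : ℕ) :
    (Tp.prim 1 a).interp ⊆ (R i (Tp.prim 1 a)).interp := by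
  fin_cases i
  · exact subset_rfl
  · refine Tp.prim_interp_subset_over _ (fun _ => rfl) fun v => Or.inl ⟨0, ?_⟩
    exact Subsingleton.elim (α := Fin 1) _ _
  · refine Tp.prim_interp_subset_over _ (fun _ => rfl) fun v => ?_
    have hv : ∀ v : Fin 2, v = 0 ∨ v = 1 := by decide
    obtain rfl | rfl := hv v
    · exact Or.inl ⟨0, rfl⟩
    · exact Or.inr ⟨(0 : Fin 1), (0 : Fin 1), rfl⟩
  · refine Tp.prim_interp_subset_over _ (fun _ => rfl) fun v => ?_
    have hv : ∀ v : Fin 2, v = 0 ∨ v = 1 := by decide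
    obtain rfl | rfl := hv v
    · exact Or.inl ⟨0, rfl⟩
    · exact Or.inr ⟨(1 : Fin 2), (0 : Fin 1), rfl⟩

/-- The colouring of an edge whose attachment nodes have the colours `a` and `b`. -/
def Colouring.edge (a b : ℕ) : Colouring where
  outer j := {k | (j = 0 ∧ k = a) ∨ (j = 1 ∧ k = b)}
  inner := ∅

/-- Each unary edge inside the product gets its own primitive colour, which is admissible for every
`R i`. Equality of colourings also concerns positions beyond the rank; there both sides are empty.
-/
theorem Colouring.edge_mem_M (a b : ℕ) (i j : Fin 4) :
    Colouring.edge a b ∈ (M (Tp.prim 1 a) (Tp.prim 1 b) i j).interp := by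
  let y : Fin 2 → Colouring := fun e => ⟨fun _ => {![a, b] e}, ∅⟩
  have hy : ∀ e, y e ∈ (Tp.prim 1 (![a, b] e)).interp := fun e =>
    ⟨fun _ _ => rfl, empty_subset _⟩
  refine ⟨y, ?_, ?_⟩
  · intro e
    have he : ∀ e : Fin 2, e = 0 ∨ e = 1 := by decide
    obtain rfl | rfl := he e
    · exact Tp.prim_interp_subset_R i a (hy 0)
    · exact Tp.prim_interp_subset_R j b (hy 1)
  · ext1
    · funext m
      ext k
      constructor
      · rintro (⟨rfl, rfl⟩ | ⟨rfl, rfl⟩)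
        · exact ⟨Nat.zero_lt_two, (0 : Fin 2), (0 : Fin 1), rfl, rfl⟩
        · exact ⟨Nat.one_lt_two, (1 : Fin 2), (0 : Fin 1), rfl, rfl⟩
      · rintro ⟨hm, e, i, he, hk⟩
        have h : ∀ (e : Fin 2), (![0, 1] : Fin 2 → Fin 2) e = ⟨m, hm⟩ → k ∈ (y e).outer 0 →
            (m = 0 ∧ k = a) ∨ (m = 1 ∧ k = b) := by
          intro e he hk
          have he' := congrArg Fin.val he
          fin_cases e
          · exact Or.inl ⟨he'.symm, hk⟩
          · exact Or.inr ⟨he'.symm, hk⟩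
        exact h e he hk
    · ext s
      constructor
      · rintro ⟨⟩
      · rintro (⟨v, hv, -⟩ | ⟨e, ⟨⟩⟩)
        exact hv ⟨v, rfl⟩

/-- Both nodes in `S` are internal and each carries one unary edge, so their colour sets are `{a}`
and `{b}`. -/
theorem Tp.inner_of_mem_interp_S {a b : ℕ} {x : Colouring}
    (hx : x ∈ (S (Tp.prim 1 a) (Tp.prim 1 b)).interp) :
    x.inner.Nonempty ∧ x.inner ⊆ {{a}, {b}} := by
  obtain ⟨y, hy, rfl⟩ := hx
  have hc : ∀ e : Fin 2, Tp.prim 1 (![a, b] e) = (![Tp.prim 1 a, Tp.prim 1 b] : Fin 2 → Tp 1) e :=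
    by
    intro e
    fin_cases e <;> rfl
  have hy' : ∀ e : Fin 2, y e ∈ (Tp.prim 1 (![a, b] e)).interp := fun e => by
    rw [hc]
    exact hy e
  have hab : ∀ e : Fin 2, ({![a, b] e} : Set ℕ) ∈ ({{a}, {b}} : Set (Set ℕ)) := fun e => by
    fin_cases e <;> simp
  refine ⟨⟨_, Or.inl ⟨(0 : Fin 2), ?_, rfl⟩⟩, ?_⟩
  · rintro ⟨i, -⟩
    exact i.elim0
  · rintro s (⟨v, -, rfl⟩ | ⟨e, hs⟩)
    · convert hab v
      ext k
      have hv : ∀ e : Fin 2, (![0, 1] : Fin 2 → Fin 2) e = e := by decide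
      constructor
      · rintro ⟨e, i, he, hk⟩
        have hev : e = v := (hv e).symm.trans he
        subst hev
        rw [(hy' e).1 i i.2] at hk
        exact hk
      · intro hk
        refine ⟨v, (0 : Fin 1), hv v, ?_⟩
        change k ∈ (y v).outer 0
        rw [(hy' v).1 0 Nat.one_pos]
        exact hk
    · have h := (hy' e).2 hs
      rw [mem_singleton_iff.1 h]
      exact hab e

theorem Star.rank_eq_two {n : ℕ} (s : Star n) : n = 2 := by
  cases s
  rfl

theorem mem_L2_of_HL {a b : ℕ} (hab : a ≠ b) (G : Hypergraph Star 0) (f : (e : G.E) → Tp (G.rk e))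
    (hf : ∀ e, ∃ i j : Fin 4, (⟨G.rk e, f e⟩ : Σ n, Tp n) = ⟨2, M (.prim 1 a) (.prim 1 b) i j⟩)
    (h : HL (G.mapLab f) (S (.prim 1 a) (.prim 1 b))) : (⟨0, G⟩ : Σ n, Hypergraph Star n) ∈ L2 := by
  -- One colouring serves all edges, whichever `M` type each of them was assigned.
  let y : G.E → Colouring := fun _ => Colouring.edge a b
  have hS := Tp.inner_of_mem_interp_S (h.sound y fun e => by
    obtain ⟨i, j, hij⟩ := hf e
    have h := congrArg (fun T : Σ n, Tp n => T.2.interp) hij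
    change y e ∈ (f e).interp
    exact h ▸ Colouring.edge_mem_M a b i j)
  have hext : ∀ v, v ∉ range G.ext := by
    rintro v ⟨i, -⟩
    exact i.elim0
  have hv : ∀ v, G.colours y v = {a} ∨ G.colours y v = {b} := fun v =>
    hS.2 (Or.inl ⟨v, hext v, rfl⟩)
  refine ⟨⟨rfl, ?_, fun e => Star.rank_eq_two (G.lab e), fun v => ?_⟩,
    {v | G.colours y v = {a}}, {v | G.colours y v = {b}}, ?_, ?_, ?_⟩
  -- The colour set `s` must come from a node of `G`, since the edges contribute no internal nodes.
  · obtain ⟨s, ⟨v, -, -⟩ | ⟨e, ⟨⟩⟩⟩ := hS.1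
    exact ⟨v⟩
  · have : (G.colours y v).Nonempty := by
      rcases hv v with h | h <;> rw [h] <;> exact singleton_nonempty _
    obtain ⟨k, e, i, hi, -⟩ := this
    exact ⟨e, i, hi⟩
  · rw [disjoint_left]
    intro v (h₁ : _ = _) (h₂ : _ = _)
    exact hab (singleton_injective (h₁.symm.trans h₂))
  · exact eq_univ_of_forall hv
  · intro e i
    constructor
    · intro hi
      -- A first attachment node receives the colour `a`, which excludes the colour set `{b}`.
      have hmem : a ∈ G.colours y (G.att e i) := ⟨e, i, rfl, Or.inl ⟨hi, rfl⟩⟩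
      refine (hv _).resolve_right fun h => ?_
      rw [h] at hmem
      exact hab hmem
    · intro hi
      have hmem : b ∈ G.colours y (G.att e i) := ⟨e, i, rfl, Or.inr ⟨hi, rfl⟩⟩
      refine (hv _).resolve_left fun h => ?_
      rw [h] at hmem
      exact hab hmem.symm

/-! ### Every graph in `L2` is generated -/

theorem Tp.Same.cast {m n : ℕ} (h : m = n) (T : Tp m) : Tp.Same T (cast (congrArg Tp h) T) := by
  subst h
  exact Tp.Same.refl T

theorem exists_HL_of_mem_L2 (a b : ℕ) (G : Hypergraph Star 0)
    (hG : (⟨0, G⟩ : Σ n, Hypergraph Star n) ∈ L2) :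
    ∃ f : (e : G.E) → Tp (G.rk e),
      (∀ e, ∃ i j : Fin 4, (⟨G.rk e, f e⟩ : Σ n, Tp n) = ⟨2, M (.prim 1 a) (.prim 1 b) i j⟩) ∧
      HL (G.mapLab f) (S (.prim 1 a) (.prim 1 b)) := by
  classical
  obtain ⟨⟨-, ⟨v₀⟩, hrk, hiso⟩, V₁, V₂, hdisj, -, hbip⟩ := hG
  replace hrk : ∀ e : G.E, G.rk e = 2 := hrk
  have := G.finV
  have := G.finE
  let att : G.E → Fin 2 ↪ G.V := fun e => (finCongr (hrk e).symm).toEmbedding.trans (G.att e)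
  let g : G.E × Fin 2 → G.V := fun y => att y.1 y.2
  -- Absence of isolated nodes is what allows a designated edge end at every node.
  have hg : Surjective g := fun v => by
    obtain ⟨e, i, hi⟩ := hiso v
    exact ⟨(e, Fin.cast (hrk e) i), hi⟩
  let d := surjInv hg
  have hd : ∀ v, g (d v) = v := surjInv_eq hg
  let col : G.V → Fin 2 := fun v => if v ∈ V₁ then 0 else 1
  have hcol : ∀ y, col (g y) = y.2 := by
    rintro ⟨e, i⟩
    have hi : ∀ i : Fin 2, i = 0 ∨ i = 1 := by decide
    have h := hbip e (Fin.cast (hrk e).symm i)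
    obtain rfl | rfl := hi i
    · exact if_pos (h.1 rfl)
    · exact if_neg fun h' => disjoint_left.1 hdisj h' (h.2 rfl)
  -- The two ends of one edge at `v₀`, hence one root in each class.
  let root : Fin 2 → G.V := fun i => g ((d v₀).1, i)
  have hroot : ∀ i, col (root i) = i := fun i => hcol _
  -- Indices count from `0`: `0` stands for `r`, `2` for `R3` and `1` for `R2`.
  let t : G.E × Fin 2 → Fin 4 := fun y =>
    if y = d (g y) then if g y = root (col (g y)) then 0 else 2 else 1
  let c : Fin 2 → ℕ := ![a, b]
  let l : G.E → Fin 2 → Tp 1 := fun e => ![R (t (e, 0)) (.prim 1 a), R (t (e, 1)) (.prim 1 b)]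
  have hl : ∀ y : G.E × Fin 2, l y.1 y.2 = R (t y) (.prim 1 (c (col (g y)))) := by
    intro y
    rw [hcol]
    obtain ⟨e, i⟩ := y
    fin_cases i <;> rfl
  refine ⟨fun e => cast (congrArg Tp (hrk e).symm)
    (M (.prim 1 a) (.prim 1 b) (t (e, 0)) (t (e, 1))), fun e => ⟨t (e, 0), t (e, 1), ?_⟩, ?_⟩
  · exact Sigma.ext (hrk e) (cast_heq _ _)
  -- There are no unary edges before expansion, hence `Empty`.
  · have key : HL (mixed G.V G.E Empty att l (fun x => x.elim) (fun x => x.elim))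
        (S (.prim 1 a) (.prim 1 b)) := by
      refine HL.mixed_of_monadic _ _ _ _ _ _ (HL.monadic_congr (V := G.V) (Equiv.refl _)
        (Equiv.emptySum Empty (G.E × Fin 2)).symm (f := g) (lab := fun y => l y.1 y.2)
        (fun _ => rfl) (fun _ => rfl) ?_)
      refine HL.monadic_of_designated c _ _ _ g _ col d root rfl hd hroot ?_ ?_ ?_
      · intro i
        rw [hl]
        simp only [t, hd, hroot, if_true]
        rfl
      · intro v hv
        rw [hl]
        simp only [t, hd, if_true, if_neg hv]
        rfl
      · intro x hx
        rw [hl]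
        simp only [t, if_neg hx]
        rfl
    refine HL.iso (H := mixed G.V G.E Empty att l (fun x => x.elim) (fun x => x.elim))
      ⟨⟨Equiv.refl G.V, Equiv.sumEmpty G.E Empty, ?_, ?_, fun i => i.elim0⟩, ?_⟩
      (Tp.Same.refl _) key
    · rintro (e | ⟨⟨⟩⟩)
      exact hrk e
    · rintro (e | ⟨⟨⟩⟩) i
      rfl
    · rintro (e | ⟨⟨⟩⟩)
      exact Tp.Same.cast (hrk e).symm _

end HypLambek

/-- For distinct primitive types `p`, `q` of rank `1`, the grammar `HGr₂` generates `𝓛₂`. -/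
theorem mainTheorem3 (a b : ℕ) (hab : a ≠ b) :
    (HypLambek.HGr2 (HypLambek.Tp.prim 1 a) (HypLambek.Tp.prim 1 b)).language
      = HypLambek.L2 := by
  ext X
  constructor
  · rintro ⟨G, rfl, f, hf, h⟩
    exact HypLambek.mem_L2_of_HL hab G f hf h
  · obtain ⟨n, G⟩ := X
    intro hG
    obtain rfl : n = 0 := hG.1.1
    exact ⟨G, rfl, HypLambek.exists_HL_of_mem_L2 a b G hG⟩
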